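/- Let $(A,\mathfrak m)$ be a (Noetherian) Cohen–Macaulay local ring, let $I$ be an $\mathfrak m$-primary ideal, and let $M$ be a finitely generated $A$-module. For a finitely generated $A$-module $N$ put $G_I(N)=\bigoplus_{n\ge 0} I^nN/I^{n+1}N$, a graded module over the Rees algebra $\mathcal R=A[It]$, and let $$\operatorname{reg} G_I(N)=\sup\{\,n+p \;:\; p\ge 0,\ n\in\mathbb Z,\ H^p_{\mathcal R_+}(G_I(N))_n\neq 0\,\}$$ be its Castelnuovo–Mumford regularity, where $\mathcal R_+=\bigoplus_{n\ge1}I^nt^n$ (so $\operatorname{reg} 0=-\infty$). For a minimal free resolution $\cdots\to F_1\xrightarrow{\partial_1}F_0\to M\to 0$ of $M$ by finitely generated free modules let $\Omega^0(M)=M$ and $\Omega^{i}(M)=\operatorname{im}\partial_{i}\subseteq F_{i-1}$ for $i\ge 1$. Assume that $\{\operatorname{reg} G_I(\Omega^i(M))\}_{i\ge 0}$ is bounded above. Then there is a positive integer $h$, depending only on $I$ and $M$, such that for every minimal free resolution $(F_\bullet,\partial_\bullet)$ of $M$, all integers $n\ge h$ and all $i\ge 0$, $$I^nF_i\cap \operatorname{im}\partial_{i+1}=I^{\,n-h}\bigl(I^hF_i\cap\operatorname{im}\partial_{i+1}\bigr).$$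 In other words, $M$ is strongly syzygetically Artin–Rees with respect to $I$. -/

import Mathlib

universe u v w

/-- A Noetherian local ring is Cohen-Macaulay if its maximal ideal contains a regular sequence
whose length is the Krull dimension of the ring (that is, depth equals dimension). -/
structure IsCohenMacaulayLocalRing (A : Type*) [CommRing A] [IsLocalRing A]
    [IsNoetherianRing A] : Prop where
  exists_isRegular : ∃ rs : List A, (∀ r ∈ rs, r ∈ IsLocalRing.maximalIdeal A) ∧
    RingTheory.Sequence.IsRegular A rs ∧ (rs.length : WithBot ℕ∞) = ringKrullDim A

namespace GradedCech

/-! Local cohomology of a graded module `G = ⨁ₙ 𝒢 n` over a graded ring `R`, with support in the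
ideal generated by finitely many elements `f 0, …, f (s - 1)` of degree one, computed by the Čech
complex `0 → G → ⨁ᵢ G_{fᵢ} → ⨁_{i<j} G_{fᵢfⱼ} → ⋯ → G_{f₀⋯f_{s-1}} → 0`. -/

section

variable {R : Type*} [CommRing R] (G : Type*) [AddCommGroup G] [Module R G]

/-- The canonical map of localizations `G_a → G_b` when `a` divides `b`. -/
noncomputable def restrict {a b : R} (h : a ∣ b) :
    LocalizedModule (Submonoid.powers a) G →ₗ[R] LocalizedModule (Submonoid.powers b) G :=
  LocalizedModule.lift (Submonoid.powers a) (LocalizedModule.mkLinearMap (Submonoid.powers b) G)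
    (by
      rintro ⟨_, k, rfl⟩
      obtain ⟨c, rfl⟩ := h
      have hu : IsUnit (algebraMap R (Module.End R
          (LocalizedModule (Submonoid.powers (a * c)) G)) (a * c)) :=
        IsLocalizedModule.map_units (LocalizedModule.mkLinearMap (Submonoid.powers (a * c)) G)
          ⟨a * c, Submonoid.mem_powers _⟩
      rw [map_mul] at hu
      have hc : Commute (algebraMap R (Module.End R
          (LocalizedModule (Submonoid.powers (a * c)) G)) a) (algebraMap R _ c) :=
        Algebra.commutes a _
      simpa only [map_pow] using (hc.isUnit_mul_iff.mp hu).1.pow k)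

variable {s : ℕ} (f : Fin s → R)

/-- The product `f_{σ 0} ⋯ f_{σ (p - 1)}` attached to an increasing sequence of `p` indices. -/
def prodAt {p : ℕ} (σ : Fin p ↪o Fin s) : R := ∏ i, f (σ i)

theorem prodAt_face_dvd {p : ℕ} (σ : Fin (p + 1) ↪o Fin s) (k : Fin (p + 1)) :
    prodAt f ((Fin.succAboveOrderEmb k).trans σ) ∣ prodAt f σ := by
  refine ⟨f (σ k), ?_⟩
  unfold prodAt
  rw [Fin.prod_univ_succAbove _ k, mul_comm]
  rfl

/-- The term of the Čech complex in cohomological degree `p`. -/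
abbrev Cochain (p : ℕ) : Type _ :=
  ∀ σ : Fin p ↪o Fin s, LocalizedModule (Submonoid.powers (prodAt f σ)) G

/-- The Čech differential: the alternating sum over the omitted index. -/
noncomputable def d (p : ℕ) : Cochain G f p →ₗ[R] Cochain G f (p + 1) :=
  LinearMap.pi fun σ => ∑ k : Fin (p + 1), (-1 : R) ^ (k : ℕ) •
    (restrict G (prodAt_face_dvd f σ k) ∘ₗ LinearMap.proj ((Fin.succAboveOrderEmb k).trans σ))

/-- The Čech coboundaries in cohomological degree `p`. -/
noncomputable def coboundaries : (p : ℕ) → Submodule R (Cochain G f p)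
  | 0 => ⊥
  | p + 1 => LinearMap.range (d G f p)

/-- The `p`-th local cohomology module `H^p_{(f)}(G)`. -/
abbrev LocalCohomology (p : ℕ) : Type _ :=
  LinearMap.ker (d G f p) ⧸ (coboundaries G f p).submoduleOf (LinearMap.ker (d G f p))

variable {G} (𝒢 : ℤ → AddSubgroup G)

/-- A Čech cochain is homogeneous of degree `n` if all its components are fractions
`g / (f_{σ 0} ⋯ f_{σ (p - 1)})^k` with `g` homogeneous of degree `n + k p`. -/
def IsHomogeneousCochain {p : ℕ} (n : ℤ) (c : Cochain G f p) : Prop :=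
  ∀ σ, ∃ k : ℕ, ∃ g ∈ 𝒢 (n + k * p),
    c σ = LocalizedModule.mk g (⟨prodAt f σ ^ k, k, rfl⟩ : Submonoid.powers (prodAt f σ))

/-- The degree `n` component `H^p_{(f)}(G)_n`. -/
def localCohomologyPiece (p : ℕ) (n : ℤ) : Set (LocalCohomology G f p) :=
  {h | ∃ z : LinearMap.ker (d G f p), IsHomogeneousCochain f 𝒢 n z.1 ∧
    Submodule.Quotient.mk z = h}

/-- `end H^p_{(f)}(G)`, the supremum of the degrees `n` with `H^p_{(f)}(G)_n ≠ 0`; it is `-∞` if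
there are none. -/
noncomputable def cohomologyEnd (p : ℕ) : EReal :=
  ⨆ n ∈ {n : ℤ | ∃ h ∈ localCohomologyPiece f 𝒢 p n, h ≠ 0}, ((n : ℝ) : EReal)

/-- The Castelnuovo-Mumford regularity `sup_p (end H^p_{(f)}(G) + p)`. -/
noncomputable def regularity : EReal :=
  ⨆ p : ℕ, cohomologyEnd f 𝒢 p + ((p : ℝ) : EReal)

end

end GradedCech

section AssociatedGraded

variable {A : Type*} [CommRing A] {I : Ideal A} {N : Type*} [AddCommGroup N] [Module A N]

/-- The filtration `n ↦ F_{n+1}`. -/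
def Ideal.Filtration.shiftOne (F : I.Filtration N) : I.Filtration N where
  N n := F.N (n + 1)
  mono n := F.mono (n + 1)
  smul_le n := F.smul_le (n + 1)

/-- The associated graded module `⨁ₙ F_n / F_{n+1}` of a filtration, as a module over the Rees
algebra `⨁ₙ I^n t^n`: the image of `⨁ₙ F_n t^n` in the quotient of `N[t]` by `⨁ₙ F_{n+1} t^n`. -/
def Ideal.Filtration.AssocGraded (F : I.Filtration N) : Type _ :=
  ↥(F.submodule.map F.shiftOne.submodule.mkQ)

noncomputable instance (F : I.Filtration N) : AddCommGroup F.AssocGraded :=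
  inferInstanceAs (AddCommGroup ↥(F.submodule.map F.shiftOne.submodule.mkQ))

noncomputable instance (F : I.Filtration N) : Module (reesAlgebra I) F.AssocGraded :=
  inferInstanceAs (Module (reesAlgebra I) ↥(F.submodule.map F.shiftOne.submodule.mkQ))

/-- The degree `n` component of the associated graded module, for `n ∈ ℤ`: the classes of the
elements of `⨁ₙ F_n t^n` that are homogeneous of degree `n`. It is zero for `n < 0`. -/
def Ideal.Filtration.assocGradedPiece (F : I.Filtration N) (n : ℤ) :
    AddSubgroup F.AssocGraded where
  carrier := {x | ∃ z ∈ F.submodule, (∀ i : ℕ, (i : ℤ) ≠ n → z.coeff i = 0) ∧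
    F.shiftOne.submodule.mkQ z = x.1}
  add_mem' := by
    rintro x y ⟨z, hz, hz0, hzx⟩ ⟨w, hw, hw0, hwy⟩
    exact ⟨z + w, add_mem hz hw, fun i hi => by simp [hz0 i hi, hw0 i hi],
      by rw [map_add, hzx, hwy]; rfl⟩
  zero_mem' := ⟨0, zero_mem _, fun i _ => by simp, by rw [map_zero]; rfl⟩
  neg_mem' := by
    rintro x ⟨z, hz, hz0, hzx⟩
    refine ⟨-z, neg_mem hz, fun i hi => ?_, by rw [map_neg, hzx]; rfl⟩
    have h : z.coeff i + (-z).coeff i = (z + -z).coeff i := by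
      rw [PolynomialModule.coeff_add]; rfl
    rw [hz0 i hi, zero_add, add_neg_cancel] at h
    simpa using h

/-- A finite generating family of an ideal in a Noetherian ring. -/
theorem Ideal.exists_fin_generators [IsNoetherianRing A] (I : Ideal A) :
    ∃ (s : ℕ) (x : Fin s → A), Ideal.span (Set.range x) = I :=
  Submodule.fg_iff_exists_fin_generating_family.mp (IsNoetherian.noetherian I)

/-- The number of elements in a chosen finite generating family of `I`. -/
noncomputable def Ideal.genCard [IsNoetherianRing A] (I : Ideal A) : ℕ :=
  I.exists_fin_generators.choose

/-- A chosen finite generating family of `I`. -/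
noncomputable def Ideal.gen [IsNoetherianRing A] (I : Ideal A) : Fin I.genCard → A :=
  I.exists_fin_generators.choose_spec.choose

theorem Ideal.span_range_gen [IsNoetherianRing A] (I : Ideal A) :
    Ideal.span (Set.range I.gen) = I :=
  I.exists_fin_generators.choose_spec.choose_spec

/-- The elements `x t` of degree one in the Rees algebra, for `x` in the chosen generating family of
`I`; they generate the irrelevant ideal `⨁_{n ≥ 1} I^n t^n`. -/
noncomputable def Ideal.reesGen [IsNoetherianRing A] (I : Ideal A) (j : Fin I.genCard) :
    reesAlgebra I :=
  ⟨Polynomial.monomial 1 (I.gen j), reesAlgebra.monomial_mem.mpr (by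
    rw [pow_one]
    exact I.span_range_gen.le (Ideal.subset_span ⟨j, rfl⟩))⟩

/-- The Castelnuovo-Mumford regularity of the associated graded module of a filtration, with
respect to local cohomology supported in the irrelevant ideal. -/
noncomputable def Ideal.Filtration.regAssocGraded [IsNoetherianRing A] (F : I.Filtration N) :
    EReal :=
  GradedCech.regularity I.reesGen F.assocGradedPiece

/-- `reg G_I(N)`, where `G_I(N) = ⨁ₙ I^n N / I^{n+1} N`. -/
noncomputable def Ideal.regGr [IsNoetherianRing A] (I : Ideal A) (N : Type*) [AddCommGroup N]
    [Module A N] : EReal :=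
  (I.stableFiltration (⊤ : Submodule A N)).regAssocGraded

end AssociatedGraded

/-- A minimal resolution `⋯ → F 1 → F 0 → M → 0` of a module over a local ring by finite free
modules. Here `d i : F (i + 1) → F i` is the differential `∂_{i+1}`. -/
structure MinimalFreeResolution (A : Type u) [CommRing A] [IsLocalRing A] (M : Type v)
    [AddCommGroup M] [Module A M] where
  F : ℕ → Type w
  [addCommGroup : ∀ i, AddCommGroup (F i)]
  [module : ∀ i, Module A (F i)]
  [free : ∀ i, Module.Free A (F i)]
  [finite : ∀ i, Module.Finite A (F i)]
  d : ∀ i, F (i + 1) →ₗ[A] F i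
  augmentation : F 0 →ₗ[A] M
  augmentation_surjective : Function.Surjective augmentation
  exact_zero : Function.Exact (d 0) augmentation
  exact_succ : ∀ i, Function.Exact (d (i + 1)) (d i)
  minimal : ∀ i, LinearMap.range (d i) ≤ IsLocalRing.maximalIdeal A • (⊤ : Submodule A (F i))

attribute [instance] MinimalFreeResolution.addCommGroup MinimalFreeResolution.module
  MinimalFreeResolution.free MinimalFreeResolution.finite

/-- `reg G_I(Ω^i(M))`, where `Ω^0(M) = M` and `Ω^{i+1}(M) = im ∂_{i+1} ⊆ F i` for a minimal free
resolution of `M`. -/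
noncomputable def MinimalFreeResolution.regGrSyzygy {A : Type*} [CommRing A] [IsLocalRing A]
    [IsNoetherianRing A] {M : Type*} [AddCommGroup M] [Module A M]
    (P : MinimalFreeResolution A M) (I : Ideal A) : ℕ → EReal
  | 0 => I.regGr M
  | i + 1 => I.regGr (LinearMap.range (P.d i))

/-! Let `N` be a syzygy, `π : F → N` its free cover, and `x_j` generators of `I`. Write `y ∈
I^{n+1}F ∩ ker π` as `∑ x_j c_j` with `c_j ∈ I^n F`. Then `∑ x_j π(c_j) = 0` is a Koszul 1-cycle of
`G_I(N)`. If `reg G_I(N) < n` it is a boundary, so modulo `I^{n+1}N` each `π(c_j)` is `∑_i x_i (b_ij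
- b_ji)`. Subtracting lifts of these terms leaves `y` unchanged by antisymmetry and moves the `c_j`
into `ker π` up to `I^{n+1}F`. Hence `y ∈ I(I^nF ∩ ker π) + I^{n+2}F ∩ ker π`
(`pow_succ_inf_ker_le_of_regGr_le`). Iteration pushes the error arbitrarily deep, where ordinary
Artin–Rees absorbs it; the Artin–Rees number of `F` does not enter the final bound, which depends on
the regularity alone.

The Koszul vanishing (`exists_eq_sum_smul_sub_of_regularity_le`) comes from the Koszul–Čech double
complex. Its Koszul direction is exact in positive Čech degree, where some `f_i` is invertible; its
Čech direction is exact in the relevant degrees by the regularity bound. A zigzag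
(`exists_d_sub_curryLeft_eq_zero`) combines the two.

Uniqueness of minimal free covers carries the result from one resolution to all. -/

namespace GradedCech

/-! ### Fractions with denominator a power of one element. -/

section Localization

variable {R : Type*} [CommRing R] {G : Type*} [AddCommGroup G] [Module R G]

/-- The fraction `g / a ^ k`. -/
noncomputable def frac (a : R) (g : G) (k : ℕ) : LocalizedModule (Submonoid.powers a) G :=
  LocalizedModule.mk g (⟨a ^ k, k, rfl⟩ : Submonoid.powers a)

theorem exists_eq_frac (a : R) (x : LocalizedModule (Submonoid.powers a) G) :
    ∃ g k, x = frac a g k := by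
  induction x using LocalizedModule.induction_on with
  | h g t =>
    obtain ⟨_, k, rfl⟩ := t
    exact ⟨g, k, rfl⟩

theorem smul_frac (a r : R) (g : G) (k : ℕ) : r • frac a g k = frac a (r • g) k :=
  LocalizedModule.smul'_mk _ _ _

theorem frac_add (a : R) (g h : G) (k : ℕ) : frac a (g + h) k = frac a g k + frac a h k := by
  unfold frac
  rw [LocalizedModule.mk_add_mk, LocalizedModule.mk_eq]
  refine ⟨1, ?_⟩
  simp only [Submonoid.smul_def, Submonoid.coe_mul, Submonoid.coe_one, smul_add, smul_smul,
    one_mul]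

theorem frac_eq_frac_add (a : R) (g : G) (k l : ℕ) :
    frac a g k = frac a (a ^ l • g) (k + l) := by
  unfold frac
  rw [LocalizedModule.mk_eq]
  refine ⟨1, ?_⟩
  simp only [Submonoid.smul_def, smul_smul, one_smul, pow_add]

theorem frac_eq_zero_iff (a : R) (g : G) (k : ℕ) : frac a g k = 0 ↔ ∃ l, a ^ l • g = 0 := by
  unfold frac
  constructor
  · intro h
    rw [← LocalizedModule.zero_mk 1, LocalizedModule.mk_eq] at h
    obtain ⟨⟨_, l, rfl⟩, h⟩ := h
    refine ⟨l, ?_⟩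
    simpa [Submonoid.smul_def] using h
  · rintro ⟨l, h⟩
    rw [← LocalizedModule.zero_mk 1, LocalizedModule.mk_eq]
    refine ⟨⟨_, l, rfl⟩, ?_⟩
    simpa [Submonoid.smul_def] using h

@[simp]
theorem frac_zero (a : R) (k : ℕ) : frac a (0 : G) k = 0 :=
  LocalizedModule.zero_mk _

theorem pow_smul_frac (a : R) (g : G) (k : ℕ) : a ^ k • frac a g k = frac a g 0 := by
  rw [smul_frac, frac_eq_frac_add a g 0 k, zero_add]

/-- Powers of `a` act invertibly, so identities of fractions may be checked after clearing
denominators. -/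
theorem pow_smul_injective (a : R) (k : ℕ) {x y : LocalizedModule (Submonoid.powers a) G}
    (h : a ^ k • x = a ^ k • y) : x = y := by
  have hdiv := LocalizedModule.divBy_mul_by (M := G) (⟨a ^ k, k, rfl⟩ : Submonoid.powers a)
  rw [← hdiv x, ← hdiv y]
  exact congrArg _ h

theorem restrict_frac {a b c : R} (h : b = a * c) (g : G) (k : ℕ) :
    restrict G (Dvd.intro c h.symm) (frac a g k) = frac b (c ^ k • g) k := by
  have key : ∀ g : G, restrict G (Dvd.intro c h.symm) (frac a g 0) = frac b g 0 := by
    intro g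
    have h1 : frac a g 0 = LocalizedModule.mk g 1 := by
      unfold frac; congr 1; ext; simp
    have h2 : frac b g 0 = LocalizedModule.mk g 1 := by
      unfold frac; congr 1; ext; simp
    rw [h1, h2]
    exact LocalizedModule.lift_mk_one _ _ _ g
  apply pow_smul_injective b k
  have hb : b ^ k = c ^ k * a ^ k := by rw [h, mul_pow, mul_comm]
  rw [pow_smul_frac, hb, mul_smul, ← map_smul, pow_smul_frac, key, smul_frac]

theorem restrict_restrict {a b c : R} (hab : a ∣ b) (hbc : b ∣ c)
    (x : LocalizedModule (Submonoid.powers a) G) :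
    restrict G hbc (restrict G hab x) = restrict G (hab.trans hbc) x := by
  obtain ⟨g, k, rfl⟩ := exists_eq_frac a x
  obtain ⟨p, hp⟩ := id hab
  obtain ⟨q, hq⟩ := id hbc
  rw [restrict_frac hp, restrict_frac hq, restrict_frac (a := a) (b := c) (c := p * q)
    (by rw [hq, hp, mul_assoc]), smul_smul, mul_pow, mul_comm]

end Localization

/-! ### The Čech differential squares to zero. -/

section Differential

variable {R : Type*} [CommRing R] {G : Type*} [AddCommGroup G] [Module R G]
  {s : ℕ} (f : Fin s → R)

theorem d_apply {p : ℕ} (c : Cochain G f p) (σ : Fin (p + 1) ↪o Fin s) :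
    d G f p c σ = ∑ k : Fin (p + 1), (-1 : R) ^ (k : ℕ) •
      restrict G (prodAt_face_dvd f σ k) (c ((Fin.succAboveOrderEmb k).trans σ)) := by
  simp [d, LinearMap.pi_apply]

theorem restrict_congr {p : ℕ} (c : Cochain G f p) {τ τ' : Fin p ↪o Fin s} (h : τ = τ') {b : R}
    (hτ : prodAt f τ ∣ b) (hτ' : prodAt f τ' ∣ b) :
    restrict G hτ (c τ) = restrict G hτ' (c τ') := by
  subst h; rfl

theorem d_comp_d (p : ℕ) (c : Cochain G f p) : d G f (p + 1) (d G f p c) = 0 := by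
  funext σ
  simp only [d_apply, map_sum, map_smul, Finset.smul_sum, restrict_restrict, Pi.zero_apply]
  -- The double sum splits into pairs omitting the same two indices in opposite orders; their signs
  -- are opposite.
  rw [Fin.sum_sum_eq_sum_triangle_add]
  refine Finset.sum_eq_zero fun i _ => Finset.sum_eq_zero fun j hj => ?_
  rw [Finset.mem_Ici] at hj
  have h : (Fin.succAboveOrderEmb j).trans ((Fin.succAboveOrderEmb i.castSucc).trans σ) =
      (Fin.succAboveOrderEmb i).trans ((Fin.succAboveOrderEmb j.succ).trans σ) := by
    ext k
    have := Fin.succAbove_succAbove_succAbove_predAbove i.castSucc j k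
    rw [Fin.succAbove_of_le_castSucc _ _ (Fin.castSucc_le_castSucc_iff.mpr hj),
      Fin.predAbove_castSucc_of_le _ _ hj] at this
    simp [this]
  rw [restrict_congr f c h _ ((prodAt_face_dvd f _ i).trans (prodAt_face_dvd f σ j.succ)),
    smul_smul, smul_smul, ← add_smul]
  convert zero_smul R _
  simp only [Fin.val_castSucc, Fin.val_succ]
  ring

end Differential

/-! ### Homogeneous components of fractions. -/

/-- Degree projections on a module graded by `𝒢`, commuting with the elements `f j` of degree
one. -/
structure HomogeneousProjections {R : Type*} [CommRing R] {G : Type*} [AddCommGroup G] [Module R G]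
    {s : ℕ} (f : Fin s → R) (𝒢 : ℤ → AddSubgroup G) where
  proj : ℤ → G →+ G
  proj_mem : ∀ n g, proj n g ∈ 𝒢 n
  proj_eq_self : ∀ n, ∀ g ∈ 𝒢 n, proj n g = g
  proj_smul : ∀ n j g, proj (n + 1) (f j • g) = f j • proj n g

namespace HomogeneousProjections

variable {R : Type*} [CommRing R] {G : Type*} [AddCommGroup G] [Module R G]
  {s : ℕ} {f : Fin s → R} {𝒢 : ℤ → AddSubgroup G}

theorem smul_mem (π : HomogeneousProjections f 𝒢) {n : ℤ} {g : G} (hg : g ∈ 𝒢 n) (j : Fin s) :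
    f j • g ∈ 𝒢 (n + 1) := by
  rw [← π.proj_eq_self n g hg, ← π.proj_smul]
  exact π.proj_mem _ _
end HomogeneousProjections

end GradedCech

namespace GradedCech

namespace HomogeneousProjections

variable {R : Type*} [CommRing R] {G : Type*} [AddCommGroup G] [Module R G]
  {s : ℕ} {f : Fin s → R} {𝒢 : ℤ → AddSubgroup G} (π : HomogeneousProjections f 𝒢)

theorem proj_prod_smul {p : ℕ} (x : Fin p → Fin s) (n : ℤ) (g : G) :
    π.proj (n + p) ((∏ i, f (x i)) • g) = (∏ i, f (x i)) • π.proj n g := by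
  induction p generalizing n g with
  | zero => simp
  | succ p ih =>
    rw [Fin.prod_univ_succ, mul_smul, mul_smul, ← ih (fun i => x i.succ), ← π.proj_smul]
    push_cast
    rw [add_assoc]

theorem proj_prodAt_pow_smul {p : ℕ} (σ : Fin p ↪o Fin s) (n : ℤ) (k : ℕ) (g : G) :
    π.proj (n + k * p) (prodAt f σ ^ k • g) = prodAt f σ ^ k • π.proj n g := by
  induction k generalizing n g with
  | zero => simp
  | succ k ih =>
    have h : π.proj (n + p) (prodAt f σ • g) = prodAt f σ • π.proj n g := π.proj_prod_smul σ n g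
    rw [pow_succ, mul_smul, mul_smul, ← h, ← ih]
    push_cast
    congr 2
    ring

theorem proj_pow_smul (j : Fin s) (n : ℤ) (k : ℕ) (g : G) :
    π.proj (n + k) (f j ^ k • g) = f j ^ k • π.proj n g := by
  induction k generalizing n g with
  | zero => simp
  | succ k ih =>
    rw [pow_succ, mul_smul, mul_smul, ← π.proj_smul, ← ih]
    push_cast
    congr 2
    ring

/-- The relation that `y` is the component of degree `n` of the fraction `x`. -/
def IsComponent (π : HomogeneousProjections f 𝒢) {p : ℕ} (σ : Fin p ↪o Fin s) (n : ℤ)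
    (x y : LocalizedModule (Submonoid.powers (prodAt f σ)) G) : Prop :=
  ∃ g k, x = frac _ g k ∧ y = frac _ (π.proj (n + k * p) g) k

variable {p : ℕ} {σ : Fin p ↪o Fin s} {n : ℤ}

theorem exists_isComponent (σ : Fin p ↪o Fin s) (n : ℤ)
    (x : LocalizedModule (Submonoid.powers (prodAt f σ)) G) : ∃ y, π.IsComponent σ n x y := by
  obtain ⟨g, k, rfl⟩ := exists_eq_frac _ x
  exact ⟨_, g, k, rfl, rfl⟩

variable {π}

theorem IsComponent.add {x y x' y' : LocalizedModule (Submonoid.powers (prodAt f σ)) G}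
    (h : π.IsComponent σ n x y) (h' : π.IsComponent σ n x' y') :
    π.IsComponent σ n (x + x') (y + y') := by
  obtain ⟨g, k, rfl, rfl⟩ := h
  obtain ⟨g', k', rfl, rfl⟩ := h'
  refine ⟨prodAt f σ ^ k' • g + prodAt f σ ^ k • g', k + k', ?_, ?_⟩
  · rw [frac_add, ← frac_eq_frac_add, add_comm k k', ← frac_eq_frac_add]
  · rw [map_add, frac_add]
    have h1 : n + ((k + k' : ℕ) : ℤ) * p = n + k * p + k' * p := by push_cast; ring
    have h2 : n + ((k + k' : ℕ) : ℤ) * p = n + k' * p + k * p := by push_cast; ring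
    congr 1
    · rw [h1, π.proj_prodAt_pow_smul, ← frac_eq_frac_add]
    · rw [h2, π.proj_prodAt_pow_smul, add_comm k k', ← frac_eq_frac_add]

/-- Only signs are allowed as scalars: `R` carries no grading here, so a general scalar need not
respect degrees. -/
theorem IsComponent.neg_one_pow_smul {x y : LocalizedModule (Submonoid.powers (prodAt f σ)) G}
    (h : π.IsComponent σ n x y) (l : ℕ) :
    π.IsComponent σ n ((-1 : R) ^ l • x) ((-1 : R) ^ l • y) := by
  obtain ⟨g, k, rfl, rfl⟩ := h
  refine ⟨(-1 : R) ^ l • g, k, smul_frac _ _ _ _, ?_⟩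
  rw [smul_frac]
  rcases neg_one_pow_eq_or R l with h | h <;> simp [h]

theorem isComponent_zero : π.IsComponent σ n 0 0 :=
  ⟨0, 0, by simp, by simp⟩

theorem isComponent_sum {ι : Type*} (t : Finset ι)
    {x y : ι → LocalizedModule (Submonoid.powers (prodAt f σ)) G}
    (h : ∀ i ∈ t, π.IsComponent σ n (x i) (y i)) :
    π.IsComponent σ n (∑ i ∈ t, x i) (∑ i ∈ t, y i) := by
  classical
  induction t using Finset.induction_on with
  | empty => simpa using isComponent_zero
  | insert a t ha ih =>
    rw [Finset.sum_insert ha, Finset.sum_insert ha]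
    exact (h a (Finset.mem_insert_self a t)).add
      (ih fun i hi => h i (Finset.mem_insert_of_mem hi))

/-- The difference is a component of `0`. A power of the denominator kills the numerator of that
zero fraction, hence also the projected numerator. -/
theorem IsComponent.eq {x y y' : LocalizedModule (Submonoid.powers (prodAt f σ)) G}
    (h : π.IsComponent σ n x y) (h' : π.IsComponent σ n x y') : y = y' := by
  have h0 := h.add (h'.neg_one_pow_smul 1)
  rw [pow_one, neg_one_smul, neg_one_smul, add_neg_cancel] at h0
  obtain ⟨g, k, hx, hy⟩ := h0
  rw [← sub_eq_zero, sub_eq_add_neg, hy, frac_eq_zero_iff]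
  obtain ⟨l, hl⟩ := (frac_eq_zero_iff _ _ _).mp hx.symm
  exact ⟨l, by rw [← π.proj_prodAt_pow_smul, hl, map_zero]⟩

theorem IsComponent.restrict {σ : Fin (p + 1) ↪o Fin s} (j : Fin (p + 1))
    {x y : LocalizedModule (Submonoid.powers (prodAt f ((Fin.succAboveOrderEmb j).trans σ))) G}
    (h : π.IsComponent _ n x y) :
    π.IsComponent σ n (restrict G (prodAt_face_dvd f σ j) x)
      (restrict G (prodAt_face_dvd f σ j) y) := by
  obtain ⟨g, k, rfl, rfl⟩ := h
  have hj : prodAt f σ = prodAt f ((Fin.succAboveOrderEmb j).trans σ) * f (σ j) := by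
    unfold prodAt
    rw [Fin.prod_univ_succAbove _ j, mul_comm]
    rfl
  refine ⟨f (σ j) ^ k • g, k, restrict_frac hj _ _, ?_⟩
  rw [restrict_frac hj, ← π.proj_pow_smul]
  congr 2
  push_cast
  ring_nf

end HomogeneousProjections

/-! ### Homogeneous Čech cochains. -/

section Homogeneous

variable {R : Type*} [CommRing R] {G : Type*} [AddCommGroup G] [Module R G]
  {s : ℕ} {f : Fin s → R} {𝒢 : ℤ → AddSubgroup G}

theorem isHomogeneousCochain_iff (π : HomogeneousProjections f 𝒢)
    {p : ℕ} {n : ℤ} {c : Cochain G f p} :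
    IsHomogeneousCochain f 𝒢 n c ↔ ∀ σ, π.IsComponent σ n (c σ) (c σ) := by
  refine forall_congr' fun σ => ⟨?_, ?_⟩
  · rintro ⟨k, g, hg, h⟩
    refine ⟨g, k, h, ?_⟩
    rw [π.proj_eq_self _ g hg]
    exact h
  · rintro ⟨g, k, -, h⟩
    exact ⟨k, _, π.proj_mem _ _, h⟩

theorem isHomogeneousCochain_of_isComponent (π : HomogeneousProjections f 𝒢)
    {p : ℕ} {n : ℤ} {c c' : Cochain G f p}
    (h : ∀ σ, π.IsComponent σ n (c σ) (c' σ)) : IsHomogeneousCochain f 𝒢 n c' := fun σ => by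
  obtain ⟨g, k, -, h⟩ := h σ
  exact ⟨k, _, π.proj_mem _ _, h⟩

theorem isComponent_d (π : HomogeneousProjections f 𝒢) {p : ℕ} {n : ℤ} {c c' : Cochain G f p}
    (h : ∀ σ, π.IsComponent σ n (c σ) (c' σ)) (σ : Fin (p + 1) ↪o Fin s) :
    π.IsComponent σ n (d G f p c σ) (d G f p c' σ) := by
  rw [d_apply, d_apply]
  exact HomogeneousProjections.isComponent_sum _ fun j _ =>
    ((h _).restrict j).neg_one_pow_smul _

theorem IsHomogeneousCochain.d (π : HomogeneousProjections f 𝒢) {p : ℕ} {n : ℤ} {c : Cochain G f p}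
    (hc : IsHomogeneousCochain f 𝒢 n c) : IsHomogeneousCochain f 𝒢 n (d G f p c) :=
  (isHomogeneousCochain_iff π).mpr (isComponent_d π ((isHomogeneousCochain_iff π).mp hc))

theorem IsHomogeneousCochain.add (π : HomogeneousProjections f 𝒢)
    {p : ℕ} {n : ℤ} {c c' : Cochain G f p}
    (hc : IsHomogeneousCochain f 𝒢 n c) (hc' : IsHomogeneousCochain f 𝒢 n c') :
    IsHomogeneousCochain f 𝒢 n (c + c') :=
  (isHomogeneousCochain_iff π).mpr fun σ =>
    ((isHomogeneousCochain_iff π).mp hc σ).add ((isHomogeneousCochain_iff π).mp hc' σ)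

theorem IsHomogeneousCochain.neg_one_pow_smul (π : HomogeneousProjections f 𝒢)
    {p : ℕ} {n : ℤ} {c : Cochain G f p}
    (hc : IsHomogeneousCochain f 𝒢 n c) (l : ℕ) :
    IsHomogeneousCochain f 𝒢 n ((-1 : R) ^ l • c) :=
  (isHomogeneousCochain_iff π).mpr fun σ =>
    ((isHomogeneousCochain_iff π).mp hc σ).neg_one_pow_smul l

theorem IsHomogeneousCochain.sum (π : HomogeneousProjections f 𝒢)
    {p : ℕ} {n : ℤ} {ι : Type*} (t : Finset ι)
    {c : ι → Cochain G f p} (hc : ∀ i ∈ t, IsHomogeneousCochain f 𝒢 n (c i)) :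
    IsHomogeneousCochain f 𝒢 n (∑ i ∈ t, c i) :=
  (isHomogeneousCochain_iff π).mpr fun σ => by
    rw [Finset.sum_apply]
    exact HomogeneousProjections.isComponent_sum _ fun i hi =>
      (isHomogeneousCochain_iff π).mp (hc i hi) σ

theorem isHomogeneousCochain_zero (π : HomogeneousProjections f 𝒢) {p : ℕ} {n : ℤ} :
    IsHomogeneousCochain f 𝒢 n (0 : Cochain G f p) :=
  (isHomogeneousCochain_iff π).mpr fun _ => HomogeneousProjections.isComponent_zero

theorem IsHomogeneousCochain.smul (π : HomogeneousProjections f 𝒢)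
    {p : ℕ} {n : ℤ} {c : Cochain G f p}
    (hc : IsHomogeneousCochain f 𝒢 n c) (j : Fin s) :
    IsHomogeneousCochain f 𝒢 (n + 1) (f j • c) := fun σ => by
  obtain ⟨k, g, hg, h⟩ := hc σ
  refine ⟨k, f j • g, ?_, ?_⟩
  · rw [add_right_comm]
    exact π.smul_mem hg j
  · rw [Pi.smul_apply, h]
    exact smul_frac _ _ _ _

/-- A homogeneous coboundary is the coboundary of a homogeneous cochain. -/
theorem exists_homogeneous_d_eq (π : HomogeneousProjections f 𝒢)
    {p : ℕ} {n : ℤ} {z : Cochain G f (p + 1)}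
    (hz : IsHomogeneousCochain f 𝒢 n z) (w : Cochain G f p) (hw : GradedCech.d G f p w = z) :
    ∃ w', IsHomogeneousCochain f 𝒢 n w' ∧ GradedCech.d G f p w' = z := by
  -- Take degree `n` components of `w`: the differential respects components, and `z` is its own.
  choose w' hw' using fun σ => π.exists_isComponent σ n (w σ)
  refine ⟨w', isHomogeneousCochain_of_isComponent π hw', funext fun σ => ?_⟩
  have h := isComponent_d π hw' σ
  rw [hw] at h
  exact h.eq ((isHomogeneousCochain_iff π).mp hz σ)

end Homogeneous

end GradedCech

/-! ### Alternating maps as Koszul chains; contraction with `f` is the Koszul differential. -/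

/-- The exterior product of a linear form and an alternating map. -/
def AlternatingMap.wedgeForm {R E N : Type*} [CommRing R] [AddCommGroup E] [Module R E]
    [AddCommGroup N] [Module R N] {i : ℕ} (φ : E →ₗ[R] R) (a : E [⋀^Fin i]→ₗ[R] N) :
    E [⋀^Fin (i + 1)]→ₗ[R] N :=
  AlternatingMap.alternatizeUncurryFin (φ.smulRight a)

theorem AlternatingMap.wedgeForm_apply {R E N : Type*} [CommRing R] [AddCommGroup E] [Module R E]
    [AddCommGroup N] [Module R N] {i : ℕ} (φ : E →ₗ[R] R) (a : E [⋀^Fin i]→ₗ[R] N)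
    (v : Fin (i + 1) → E) :
    wedgeForm φ a v = ∑ j : Fin (i + 1), (-1 : R) ^ (j : ℕ) • φ (v j) • a (j.removeNth v) := by
  rw [wedgeForm, alternatizeUncurryFin_apply]
  refine Finset.sum_congr rfl fun j _ => ?_
  rcases Nat.even_or_odd (j : ℕ) with h | h <;> simp [h.neg_one_pow]

/-- Contraction is an antiderivation: `ι_x(φ ∧ a) = φ(x) a - φ ∧ ι_x a`, and the last term vanishes.
-/
theorem AlternatingMap.curryLeft_wedgeForm {R E N : Type*} [CommRing R] [AddCommGroup E]
    [Module R E] [AddCommGroup N] [Module R N] {i : ℕ} (φ : E →ₗ[R] R)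
    (a : E [⋀^Fin (i + 1)]→ₗ[R] N) (x : E) (ha : a.curryLeft x = 0) :
    (wedgeForm φ a).curryLeft x = φ x • a := by
  ext v
  rw [curryLeft_apply_apply, wedgeForm_apply, Fin.sum_univ_succ, Finset.sum_eq_zero]
  · simp [Matrix.vecCons]
  · intro j _
    have h : j.succ.removeNth (Matrix.vecCons x v) = Matrix.vecCons x (j.removeNth v) := by
      funext k
      refine Fin.cases ?_ (fun k => ?_) k
      · simp [Fin.removeNth, Matrix.vecCons]
      · simp [Fin.removeNth, Matrix.vecCons]
    rw [h, ← curryLeft_apply_apply, ha]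
    simp

theorem exists_orderEmb_comp_perm {i s : ℕ} {t : Fin i → Fin s} (ht : Function.Injective t) :
    ∃ (τ : Fin i ↪o Fin s) (g : Equiv.Perm (Fin i)), t = τ ∘ g := by
  have hm : StrictMono (t ∘ Tuple.sort t) :=
    (Tuple.monotone_sort t).strictMono_of_injective (ht.comp (Tuple.sort t).injective)
  refine ⟨OrderEmbedding.ofStrictMono _ hm, (Tuple.sort t)⁻¹, ?_⟩
  funext k
  simp

/-! ### The Koszul–Čech double complex. -/

namespace GradedCech

variable {R : Type*} [CommRing R] {G : Type*} [AddCommGroup G] [Module R G]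
  {s : ℕ} {f : Fin s → R} {𝒢 : ℤ → AddSubgroup G}

/-- The tuple of standard basis vectors with the given indices. -/
def stdTuple (R : Type*) [CommRing R] {s i : ℕ} (t : Fin i → Fin s) : Fin i → Fin s → R :=
  fun l => Pi.single (t l) 1

theorem alternatingMap_ext_stdTuple {N : Type*} [AddCommGroup N] [Module R N] {i : ℕ}
    {a b : (Fin s → R) [⋀^Fin i]→ₗ[R] N}
    (h : ∀ τ : Fin i ↪o Fin s, a (stdTuple R τ) = b (stdTuple R τ)) : a = b := by
  refine (Pi.basisFun R (Fin s)).ext_alternating fun t ht => ?_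
  obtain ⟨τ, g, rfl⟩ := exists_orderEmb_comp_perm ht
  have h1 : (fun l => Pi.basisFun R (Fin s) ((τ ∘ g) l)) = stdTuple R τ ∘ g := by
    funext l
    simp [stdTuple, Pi.basisFun_apply]
  rw [h1, a.map_perm, b.map_perm, h]

/-- The Koszul cochain `a` on `R ^ s` with values in Čech cochains is homogeneous of total
degree `n`. -/
def IsHomogeneousForm (f : Fin s → R) (𝒢 : ℤ → AddSubgroup G) (n : ℤ) {i p : ℕ}
    (a : (Fin s → R) [⋀^Fin i]→ₗ[R] Cochain G f p) : Prop :=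
  ∀ t : Fin i → Fin s, IsHomogeneousCochain f 𝒢 (n - i) (a (stdTuple R t))

theorem isHomogeneousForm_of_orderEmb (π : HomogeneousProjections f 𝒢) {n : ℤ} {i p : ℕ}
    {a : (Fin s → R) [⋀^Fin i]→ₗ[R] Cochain G f p}
    (h : ∀ τ : Fin i ↪o Fin s, IsHomogeneousCochain f 𝒢 (n - i) (a (stdTuple R τ))) :
    IsHomogeneousForm f 𝒢 n a := by
  intro t
  by_cases ht : Function.Injective t
  · obtain ⟨τ, g, rfl⟩ := exists_orderEmb_comp_perm ht
    have h1 : stdTuple R (τ ∘ g) = stdTuple R τ ∘ g := rfl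
    rw [h1, a.map_perm]
    rcases Int.units_eq_one_or (Equiv.Perm.sign g) with hg | hg
    · simpa [hg] using h τ
    · simpa [hg] using (h τ).neg_one_pow_smul π 1
  · obtain ⟨x, y, hxy, hne⟩ := Function.not_injective_iff.mp ht
    rw [a.map_eq_zero_of_eq _ (by simp [stdTuple, hxy]) hne]
    exact isHomogeneousCochain_zero π

theorem alternatingMap_cons_eq_sum {N : Type*} [AddCommGroup N] [Module R N] {i : ℕ}
    (a : (Fin s → R) [⋀^Fin (i + 1)]→ₗ[R] N) (t : Fin i → Fin s) :
    a.curryLeft f (stdTuple R t) =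
      ∑ j, f j • a (stdTuple R (Fin.cons j t : Fin (i + 1) → Fin s)) := by
  have hf : f = ∑ j, f j • (Pi.single j 1 : Fin s → R) := by
    rw [← pi_eq_sum_univ' f]
  conv_lhs => rw [hf]
  let e : ((Fin s → R) [⋀^Fin i]→ₗ[R] N) →+ N :=
    ⟨⟨fun b => b (stdTuple R t), rfl⟩, fun _ _ => rfl⟩
  change e (a.curryLeft _) = _
  rw [map_sum, map_sum]
  refine Finset.sum_congr rfl fun j _ => ?_
  change a.curryLeft (f j • Pi.single j 1) (stdTuple R t) = _
  rw [map_smul, AlternatingMap.smul_apply, AlternatingMap.curryLeft_apply_apply]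
  congr 2
  funext l
  refine Fin.cases ?_ (fun k => ?_) l <;> simp [stdTuple, Matrix.vecCons]

theorem IsHomogeneousForm.curryLeft (π : HomogeneousProjections f 𝒢) {n : ℤ} {i p : ℕ}
    {a : (Fin s → R) [⋀^Fin (i + 1)]→ₗ[R] Cochain G f p} (h : IsHomogeneousForm f 𝒢 n a) :
    IsHomogeneousForm f 𝒢 n (a.curryLeft f) := by
  intro t
  rw [alternatingMap_cons_eq_sum]
  refine IsHomogeneousCochain.sum π _ fun j _ => ?_
  have := (h (Fin.cons j t)).smul π j
  convert this using 1
  push_cast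
  ring

theorem IsHomogeneousForm.d (π : HomogeneousProjections f 𝒢) {n : ℤ} {i p : ℕ}
    {a : (Fin s → R) [⋀^Fin i]→ₗ[R] Cochain G f p} (h : IsHomogeneousForm f 𝒢 n a) :
    IsHomogeneousForm f 𝒢 n ((d G f p).compAlternatingMap a) :=
  fun t => (h t).d π

/-- Division by one of the inverted elements. -/
noncomputable def divFirst {p : ℕ} (σ : Fin (p + 1) ↪o Fin s) :
    LocalizedModule (Submonoid.powers (prodAt f σ)) G →ₗ[R]
      LocalizedModule (Submonoid.powers (prodAt f σ)) G :=
  (∏ i : Fin p, f (σ i.succ)) • LocalizedModule.divBy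
    (⟨prodAt f σ, 1, pow_one _⟩ : Submonoid.powers (prodAt f σ))

theorem divFirst_frac {p : ℕ} (σ : Fin (p + 1) ↪o Fin s) (g : G) (k : ℕ) :
    divFirst σ (frac (prodAt f σ) g k) =
      frac (prodAt f σ) ((∏ i : Fin p, f (σ i.succ)) • g) (k + 1) := by
  rw [← smul_frac]
  unfold divFirst frac
  rw [LinearMap.smul_apply, LocalizedModule.divBy_apply, LocalizedModule.liftOn_mk]
  congr 2
  ext
  simp [pow_succ]

theorem smul_divFirst {p : ℕ} (σ : Fin (p + 1) ↪o Fin s)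
    (x : LocalizedModule (Submonoid.powers (prodAt f σ)) G) : f (σ 0) • divFirst σ x = x := by
  obtain ⟨g, k, rfl⟩ := exists_eq_frac _ x
  rw [divFirst_frac, smul_frac, smul_smul, ← Fin.prod_univ_succ (fun i => f (σ i)),
    frac_eq_frac_add _ g k 1, pow_one, prodAt]

theorem isComponent_divFirst (π : HomogeneousProjections f 𝒢) {p : ℕ} {σ : Fin (p + 1) ↪o Fin s}
    {n : ℤ} {x y : LocalizedModule (Submonoid.powers (prodAt f σ)) G}
    (h : π.IsComponent σ n x y) : π.IsComponent σ (n - 1) (divFirst σ x) (divFirst σ y) := by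
  obtain ⟨g, k, rfl, rfl⟩ := h
  refine ⟨_, _, divFirst_frac _ _ _, ?_⟩
  rw [divFirst_frac, ← π.proj_prod_smul]
  congr 2
  push_cast
  ring_nf

/-- Koszul exactness in positive Čech degree: on the component `σ` the element `f (σ 0)` is
invertible, so wedging with the coordinate form of `σ 0` and dividing by `f (σ 0)` is a contracting
homotopy. -/
theorem exists_curryLeft_eq (π : HomogeneousProjections f 𝒢) {n : ℤ} {i p : ℕ}
    {a : (Fin s → R) [⋀^Fin (i + 1)]→ₗ[R] Cochain G f (p + 1)} (h : IsHomogeneousForm f 𝒢 n a)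
    (ha : a.curryLeft f = 0) :
    ∃ b : (Fin s → R) [⋀^Fin (i + 2)]→ₗ[R] Cochain G f (p + 1),
      IsHomogeneousForm f 𝒢 n b ∧ b.curryLeft f = a := by
  let u : ∀ σ : Fin (p + 1) ↪o Fin s, (Fin s → R) [⋀^Fin (i + 1)]→ₗ[R]
      LocalizedModule (Submonoid.powers (prodAt f σ)) G := fun σ =>
    (divFirst σ ∘ₗ LinearMap.proj σ).compAlternatingMap a
  refine ⟨AlternatingMap.pi fun σ =>
    AlternatingMap.wedgeForm (LinearMap.proj (σ 0)) (u σ), fun t => ?_, ?_⟩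
  · rw [isHomogeneousCochain_iff π]
    intro σ
    rw [AlternatingMap.pi_apply, AlternatingMap.wedgeForm_apply]
    refine HomogeneousProjections.isComponent_sum _ fun j _ => ?_
    refine HomogeneousProjections.IsComponent.neg_one_pow_smul ?_ _
    have h1 := isComponent_divFirst π ((isHomogeneousCochain_iff π).mp (h (j.removeNth t)) σ)
    have h2 : stdTuple R (j.removeNth t) = j.removeNth (stdTuple R t) := rfl
    have h3 : n - ((i + 1 : ℕ) : ℤ) - 1 = n - ((i + 2 : ℕ) : ℤ) := by push_cast; ring
    rw [h2, h3] at h1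
    by_cases hj : σ 0 = t j
    · simpa [u, stdTuple, hj] using h1
    · simpa [stdTuple, hj] using HomogeneousProjections.isComponent_zero
  · ext v σ
    have h1 : (u σ).curryLeft f = 0 := by
      simp only [u, AlternatingMap.curryLeft_compAlternatingMap, ha]
      ext; simp
    have h2 := AlternatingMap.curryLeft_wedgeForm (LinearMap.proj (σ 0)) (u σ) f h1
    have h3 := congrArg (fun b => b v) h2
    simp only [AlternatingMap.curryLeft_apply_apply, AlternatingMap.smul_apply,
      LinearMap.proj_apply] at h3
    rw [AlternatingMap.curryLeft_apply_apply, AlternatingMap.pi_apply, h3]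
    exact smul_divFirst σ _

/-- Čech exactness passes to forms, because alternating maps out of `R ^ s` are determined freely by
their values on increasing basis tuples. -/
theorem exists_d_comp_eq (π : HomogeneousProjections f 𝒢) {n : ℤ} {i p : ℕ}
    (hH : ∀ z : Cochain G f (p + 1), IsHomogeneousCochain f 𝒢 (n - i) z →
      d G f (p + 1) z = 0 → z ∈ coboundaries G f (p + 1))
    {a : (Fin s → R) [⋀^Fin i]→ₗ[R] Cochain G f (p + 1)} (h : IsHomogeneousForm f 𝒢 n a)
    (ha : (d G f (p + 1)).compAlternatingMap a = 0) :
    ∃ b : (Fin s → R) [⋀^Fin i]→ₗ[R] Cochain G f p,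
      IsHomogeneousForm f 𝒢 n b ∧ (d G f p).compAlternatingMap b = a := by
  have key : ∀ τ : Fin i ↪o Fin s, ∃ w : Cochain G f p, IsHomogeneousCochain f 𝒢 (n - i) w ∧
      d G f p w = a (stdTuple R τ) := fun τ => by
    obtain ⟨w, hw⟩ := hH (a (stdTuple R τ)) (h τ) (congrArg (fun b => b (stdTuple R τ)) ha)
    exact exists_homogeneous_d_eq π (h τ) w hw
  choose w hw hdw using key
  let B := (Pi.basisFun R (Fin s)).exteriorPower i
  let b : (Fin s → R) [⋀^Fin i]→ₗ[R] Cochain G f p :=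
    (B.constr R fun S => w (Set.powersetCard.ofFinEmbEquiv.symm S)).compAlternatingMap
      (exteriorPower.ιMulti R i)
  have hb : ∀ τ : Fin i ↪o Fin s, b (stdTuple R τ) = w τ := by
    intro τ
    have h1 : exteriorPower.ιMulti R i (stdTuple R τ) =
        B (Set.powersetCard.ofFinEmbEquiv τ) := by
      rw [exteriorPower.basis_apply, exteriorPower.ιMulti_family, Equiv.symm_apply_apply]
      congr 1
      funext l
      simp [stdTuple]
    simp only [b, LinearMap.compAlternatingMap_apply]
    rw [h1, Module.Basis.constr_basis, Equiv.symm_apply_apply]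
  refine ⟨b, isHomogeneousForm_of_orderEmb π fun τ => ?_, alternatingMap_ext_stdTuple fun τ => ?_⟩
  · rw [hb]; exact hw τ
  · rw [LinearMap.compAlternatingMap_apply, hb, hdw]

/-- The zigzag, by descending induction on `p`: a form whose Čech differential is a Koszul cycle can
be corrected by a Koszul boundary to a Čech cocycle. -/
theorem exists_d_sub_curryLeft_eq_zero (π : HomogeneousProjections f 𝒢) {n : ℤ}
    (hH : ∀ p, ∀ z : Cochain G f p, IsHomogeneousCochain f 𝒢 (n - 1 - p) z →
      d G f p z = 0 → z ∈ coboundaries G f p) (k : ℕ) :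
    ∀ p, s ≤ p + k → ∀ z : (Fin s → R) [⋀^Fin (p + 1)]→ₗ[R] Cochain G f p,
      IsHomogeneousForm f 𝒢 n z → ((d G f p).compAlternatingMap z).curryLeft f = 0 →
      ∃ w : (Fin s → R) [⋀^Fin (p + 2)]→ₗ[R] Cochain G f p, IsHomogeneousForm f 𝒢 n w ∧
        (d G f p).compAlternatingMap (z - w.curryLeft f) = 0 := by
  induction k with
  | zero =>
    intro p hp z _ _
    -- Here `p ≥ s`, and there is no increasing tuple of `p + 1` indices below `s`.
    refine ⟨0, fun t => isHomogeneousCochain_zero π, alternatingMap_ext_stdTuple fun τ => ?_⟩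
    have := Fintype.card_le_of_embedding τ.toEmbedding
    simp only [Fintype.card_fin] at this
    omega
  | succ k ih =>
    intro p hp z hz hdz
    -- Write `dz = ι_f z'`, correct `z'` by induction to a cocycle `z' - ι_f w' = dw`; then `d(ι_f
    -- w) = ι_f z' = dz` since `ι_f² = 0`.
    obtain ⟨z', hz', hzz'⟩ := exists_curryLeft_eq π (hz.d π) hdz
    have hdd : (d G f (p + 1)).compAlternatingMap ((d G f p).compAlternatingMap z) = 0 := by
      ext v : 1
      exact d_comp_d f p (z v)
    obtain ⟨w', hw', hww'⟩ := ih (p + 1) (by omega) z' hz' (by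
      rw [AlternatingMap.curryLeft_compAlternatingMap, hzz', hdd])
    have hsub : IsHomogeneousForm f 𝒢 n (z' - w'.curryLeft f) := fun t => by
      have := (hz' t).add π ((hw'.curryLeft π t).neg_one_pow_smul π 1)
      simpa [sub_eq_add_neg] using this
    obtain ⟨w, hw, hdw⟩ := exists_d_comp_eq π (fun c hc => hH (p + 1) c (by
      convert hc using 1; push_cast; ring)) hsub hww'
    refine ⟨w, hw, ?_⟩
    have h1 : (d G f p).compAlternatingMap (w.curryLeft f) = (d G f p).compAlternatingMap z := by
      rw [← AlternatingMap.curryLeft_compAlternatingMap, hdw, ← hzz']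
      ext v : 1
      have h2 := congrArg (fun b => b v) (AlternatingMap.curryLeft_same w' f)
      simp only [AlternatingMap.curryLeft_apply_apply, AlternatingMap.sub_apply,
        AlternatingMap.zero_apply] at h2 ⊢
      rw [h2, sub_zero]
    ext v : 1
    have h2 := congrArg (fun b => b v) h1
    simp only [LinearMap.compAlternatingMap_apply, AlternatingMap.sub_apply, map_sub,
      AlternatingMap.zero_apply] at h2 ⊢
    rw [h2, sub_self]

end GradedCech

/-! ### From bounded regularity to vanishing of Koszul homology. -/

namespace GradedCech

variable {R : Type*} [CommRing R] {G : Type*} [AddCommGroup G] [Module R G]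
  {s : ℕ} {f : Fin s → R} {𝒢 : ℤ → AddSubgroup G}

theorem mem_coboundaries_of_regularity_le {β : ℝ} (h : regularity f 𝒢 ≤ (β : EReal)) {p : ℕ}
    {n : ℤ} (hn : β < n + p) {z : Cochain G f p} (hz : IsHomogeneousCochain f 𝒢 n z)
    (hdz : d G f p z = 0) : z ∈ coboundaries G f p := by
  by_contra hmem
  have h1 : ((n : ℝ) : EReal) ≤ cohomologyEnd f 𝒢 p := by
    refine le_iSup₂_of_le (f := fun (n : ℤ) _ => ((n : ℝ) : EReal)) n
      ⟨_, ⟨⟨z, hdz⟩, hz, rfl⟩, fun h0 => hmem ?_⟩ le_rfl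
    rw [Submodule.Quotient.mk_eq_zero] at h0
    exact h0
  have h2 : ((n : ℝ) : EReal) + ((p : ℝ) : EReal) ≤ (β : EReal) :=
    (add_le_add_left h1 _).trans
      ((le_iSup (fun p : ℕ => cohomologyEnd f 𝒢 p + ((p : ℝ) : EReal)) p).trans h)
  rw [← EReal.coe_add, EReal.coe_le_coe_iff] at h2
  linarith

/-- An element of the module as a Čech cochain in cohomological degree zero. -/
noncomputable def toCochainZero (f : Fin s → R) : G →ₗ[R] Cochain G f 0 where
  toFun g _ := frac _ g 0
  map_add' g h := funext fun _ => frac_add _ g h 0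
  map_smul' r g := funext fun _ => (smul_frac _ r g 0).symm

theorem prodAt_zero (σ : Fin 0 ↪o Fin s) : prodAt f σ = 1 := by
  simp [prodAt]

theorem toCochainZero_injective : Function.Injective (toCochainZero (G := G) f) := by
  rw [injective_iff_map_eq_zero]
  intro g hg
  have h1 := congrFun hg (Fin.castLEOrderEmb (Nat.zero_le s))
  obtain ⟨l, hl⟩ := (frac_eq_zero_iff _ _ _).mp h1
  simpa [prodAt_zero] using hl

theorem isHomogeneousCochain_toCochainZero {n : ℤ} {g : G} (hg : g ∈ 𝒢 n) :
    IsHomogeneousCochain f 𝒢 n (toCochainZero f g) :=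
  fun _ => ⟨0, g, by simpa using hg, rfl⟩

theorem exists_eq_toCochainZero {n : ℤ} {c : Cochain G f 0} (hc : IsHomogeneousCochain f 𝒢 n c) :
    ∃ g ∈ 𝒢 n, c = toCochainZero f g := by
  obtain ⟨k, g, hg, h⟩ := hc (Fin.castLEOrderEmb (Nat.zero_le s))
  refine ⟨g, by simpa using hg, funext fun σ => ?_⟩
  obtain rfl : σ = Fin.castLEOrderEmb (Nat.zero_le s) := by
    ext i; exact i.elim0
  refine h.trans ?_
  change frac _ g k = frac _ g 0
  rw [frac_eq_frac_add _ g 0 k, prodAt_zero, zero_add, one_pow, one_smul]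

/-- If the regularity is less than `n` then the first Koszul homology vanishes in internal
degree `n`. -/
theorem exists_eq_sum_smul_sub_of_regularity_le (π : HomogeneousProjections f 𝒢) {β : ℝ}
    (h : regularity f 𝒢 ≤ (β : EReal)) {n : ℤ} (hn : β < n) (a : Fin s → G)
    (ha : ∀ j, a j ∈ 𝒢 n) (h0 : ∑ j, f j • a j = 0) :
    ∃ c : Fin s → Fin s → G, (∀ i j, c i j ∈ 𝒢 (n - 1)) ∧
      ∀ j, a j = ∑ i, f i • (c i j - c j i) := by
  let φ : (Fin s → R) →ₗ[R] Cochain G f 0 :=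
    toCochainZero f ∘ₗ Fintype.linearCombination R a
  let z : (Fin s → R) [⋀^Fin 1]→ₗ[R] Cochain G f 0 :=
    AlternatingMap.ofSubsingleton R _ _ 0 φ
  have hz_apply : ∀ v, z v = φ (v 0) := fun v => rfl
  have hφ : ∀ j, φ (Pi.single j 1) = toCochainZero f (a j) := fun j => by
    simp [φ, Fintype.linearCombination_apply_single]
  -- Total degree is `n + 1`: values of degree `n` on a form of Koszul degree one. The vanishing
  -- required is then that of `H^p` in degree `n - p`, and `n > β`.
  have hz : IsHomogeneousForm f 𝒢 (n + 1) z := fun t => by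
    rw [hz_apply, stdTuple, hφ]
    convert isHomogeneousCochain_toCochainZero (f := f) (ha (t 0)) using 1
    push_cast
    ring
  have hdz : ((d G f 0).compAlternatingMap z).curryLeft f = 0 := by
    ext v : 1
    have h1 : φ f = 0 := by
      simp [φ, Fintype.linearCombination_apply, h0]
    rw [AlternatingMap.curryLeft_apply_apply, LinearMap.compAlternatingMap_apply, hz_apply]
    simp [Matrix.vecCons, h1]
  have hH : ∀ p, ∀ z : Cochain G f p, IsHomogeneousCochain f 𝒢 (n + 1 - 1 - p) z →
      d G f p z = 0 → z ∈ coboundaries G f p := fun p z hz hdz =>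
    mem_coboundaries_of_regularity_le h (by push_cast; linarith) hz hdz
  obtain ⟨w, hw, hdw⟩ := exists_d_sub_curryLeft_eq_zero π hH s 0 (by omega) z hz hdz
  have hzw : ∀ j, toCochainZero f (a j) = w.curryLeft f (stdTuple R fun _ => j) := by
    intro j
    have hzj : z (stdTuple R fun _ => j) = toCochainZero f (a j) := hφ j
    rw [← sub_eq_zero, ← hzj]
    have h1 := (hz fun _ => j).add π ((hw.curryLeft π fun _ => j).neg_one_pow_smul π 1)
    rw [pow_one, neg_one_smul, ← sub_eq_add_neg] at h1
    refine (Submodule.mem_bot R).mp (hH 0 _ ?_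
      (congrArg (fun b => b (stdTuple R fun _ => j)) hdw))
    convert h1 using 1
    push_cast
    ring
  have hw2 : ∀ i j : Fin s, IsHomogeneousCochain f 𝒢 (n - 1) (w (stdTuple R ![i, j])) := by
    intro i j
    convert hw ![i, j] using 1
    push_cast
    ring
  choose b hb hbw using fun i j => exists_eq_toCochainZero (hw2 i j)
  have hswap : ∀ i j, w (stdTuple R ![i, j]) = - w (stdTuple R ![j, i]) := by
    intro i j
    rw [← w.map_swap (stdTuple R ![j, i]) (i := 0) (j := 1) (by simp)]
    congr 1
    funext l
    fin_cases l <;> simp [stdTuple]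
  have hsame : ∀ i, w (stdTuple R ![i, i]) = 0 := fun i =>
    w.map_eq_zero_of_eq _ (i := 0) (j := 1) (by simp [stdTuple]) (by simp)
  -- Keeping only the half `i < j` makes `c i j - c j i` the full alternating array, without
  -- dividing by two.
  refine ⟨fun i j => if i < j then b i j else 0, fun i j => ?_, fun j => ?_⟩
  · dsimp only
    split_ifs
    · exact hb i j
    · exact zero_mem _
  · apply toCochainZero_injective (f := f)
    rw [hzw, alternatingMap_cons_eq_sum, map_sum]
    refine Finset.sum_congr rfl fun i _ => ?_
    have h1 : (Fin.cons i (fun _ => j) : Fin 2 → Fin s) = ![i, j] := by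
      funext l
      fin_cases l <;> rfl
    rw [map_smul, h1]
    congr 1
    dsimp only
    rcases lt_trichotomy i j with hij | rfl | hij
    · rw [if_pos hij, if_neg hij.asymm, sub_zero, hbw]
    · rw [hsame, sub_self, map_zero]
    · rw [if_pos hij, if_neg hij.asymm, zero_sub, map_neg, hswap, hbw]

end GradedCech

/-! ### The grading of the associated graded module. -/

section AssociatedGraded

variable {A : Type*} [CommRing A] {I : Ideal A} {N : Type*} [AddCommGroup N] [Module A N]

/-- The homogeneous component of degree `n ∈ ℤ` of an element of `N[t]`. -/
noncomputable def PolynomialModule.component (n : ℤ) :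
    PolynomialModule A N →+ PolynomialModule A N where
  toFun z := if 0 ≤ n then PolynomialModule.single A n.toNat (z.coeff n.toNat) else 0
  map_zero' := by simp
  map_add' x y := by split_ifs <;> simp

theorem PolynomialModule.coeff_component (n : ℤ) (z : PolynomialModule A N) (i : ℕ) :
    (component n z).coeff i = if (i : ℤ) = n then z.coeff i else 0 := by
  change (if 0 ≤ n then PolynomialModule.single A n.toNat (z.coeff n.toNat) else 0).coeff i = _
  split_ifs with h1 h2 h2
  · have : n.toNat = i := by omega
    simp [this]
  · have : n.toNat ≠ i := by omega
    simp [this]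
  · omega
  · simp

theorem PolynomialModule.component_monomial_one_smul (n : ℤ) (r : A) (z : PolynomialModule A N) :
    component (n + 1) (Polynomial.monomial 1 r • z) =
      Polynomial.monomial 1 r • component n z := by
  ext i
  rw [coeff_component, monomial_smul_apply, monomial_smul_apply, coeff_component]
  split_ifs <;> first | rfl | omega | simp

namespace Ideal.Filtration

variable (F : I.Filtration N)

theorem component_mem_submodule (n : ℤ) {z : PolynomialModule A N} (hz : z ∈ F.submodule) :
    PolynomialModule.component n z ∈ F.submodule := fun i => by
  rw [PolynomialModule.coeff_component]
  split_ifs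
  · exact hz i
  · exact zero_mem _

/-- Makes the component of a class independent of the chosen lift. -/
theorem mkQ_component_congr (n : ℤ) {z w : PolynomialModule A N}
    (h : F.shiftOne.submodule.mkQ z = F.shiftOne.submodule.mkQ w) :
    F.shiftOne.submodule.mkQ (PolynomialModule.component n z) =
      F.shiftOne.submodule.mkQ (PolynomialModule.component n w) := by
  rw [← sub_eq_zero, ← map_sub, Submodule.mkQ_apply, Submodule.Quotient.mk_eq_zero] at h ⊢
  rw [← map_sub]
  exact F.shiftOne.component_mem_submodule n h

/-- The class of an element of `⨁ₙ F_n t^n` in the associated graded module. -/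
noncomputable def toGr : F.submodule →ₗ[reesAlgebra I] F.AssocGraded :=
  (F.shiftOne.submodule.mkQ.submoduleMap F.submodule)

theorem coe_toGr (z : F.submodule) : (F.toGr z).1 = F.shiftOne.submodule.mkQ z.1 := rfl

theorem toGr_surjective : Function.Surjective F.toGr :=
  LinearMap.submoduleMap_surjective _ _

/-- The homogeneous component of degree `n ∈ ℤ` of an element of `⨁ₙ F_n t^n`. -/
noncomputable def componentSubmodule (n : ℤ) : F.submodule →+ F.submodule where
  toFun z := ⟨_, F.component_mem_submodule n z.2⟩
  map_zero' := Subtype.ext (map_zero _)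
  map_add' x y := Subtype.ext (map_add (PolynomialModule.component n) x.1 y.1)

/-- The homogeneous component of degree `n ∈ ℤ` on the associated graded module. -/
noncomputable def grComponent (n : ℤ) : F.AssocGraded →+ F.AssocGraded :=
  AddMonoidHom.mk' (fun x => F.toGr (F.componentSubmodule n (F.toGr_surjective x).choose))
    fun x y => by
      rw [← map_add, ← map_add]
      refine Subtype.ext (F.mkQ_component_congr n ?_)
      rw [← coe_toGr, ← coe_toGr, map_add, (F.toGr_surjective _).choose_spec,
        (F.toGr_surjective _).choose_spec, (F.toGr_surjective _).choose_spec]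

theorem grComponent_toGr (n : ℤ) (z : F.submodule) :
    F.grComponent n (F.toGr z) = F.toGr (F.componentSubmodule n z) :=
  Subtype.ext (F.mkQ_component_congr n
    (congrArg Subtype.val (F.toGr_surjective (F.toGr z)).choose_spec))

theorem mem_assocGradedPiece_iff {n : ℤ} {x : F.AssocGraded} :
    x ∈ F.assocGradedPiece n ↔
      ∃ z : F.submodule, (∀ i : ℕ, (i : ℤ) ≠ n → z.1.coeff i = 0) ∧ F.toGr z = x := by
  constructor
  · rintro ⟨z, hz, h0, h⟩
    exact ⟨⟨z, hz⟩, h0, Subtype.ext h⟩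
  · rintro ⟨z, h0, rfl⟩
    exact ⟨z.1, z.2, h0, rfl⟩

/-- The projections of the associated graded module onto its homogeneous components. -/
noncomputable def homogeneousProjections [IsNoetherianRing A] :
    GradedCech.HomogeneousProjections I.reesGen F.assocGradedPiece where
  proj := F.grComponent
  proj_mem n x := by
    obtain ⟨z, rfl⟩ := F.toGr_surjective x
    rw [grComponent_toGr, mem_assocGradedPiece_iff]
    refine ⟨_, fun i hi => ?_, rfl⟩
    exact (PolynomialModule.coeff_component n z.1 i).trans (if_neg hi)
  proj_eq_self n x hx := by
    obtain ⟨z, h0, rfl⟩ := F.mem_assocGradedPiece_iff.mp hx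
    rw [grComponent_toGr]
    congr 1
    refine Subtype.ext (PolynomialModule.ext (Finsupp.ext fun i => ?_))
    refine (PolynomialModule.coeff_component n z.1 i).trans ?_
    split_ifs with hi
    · rfl
    · exact (h0 i hi).symm
  proj_smul n j x := by
    obtain ⟨z, rfl⟩ := F.toGr_surjective x
    rw [← map_smul, grComponent_toGr, grComponent_toGr, ← map_smul]
    congr 1
    exact Subtype.ext (PolynomialModule.component_monomial_one_smul n (I.gen j) z.1)

end Ideal.Filtration

/-! ### Lifting Koszul relations from `G_I(N)` to `N`, then to a cover of `N`. -/

variable [IsNoetherianRing A]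

/-- Koszul vanishing in degree `n + 1`, read on representatives: equality in the associated graded
module becomes congruence modulo `I^{n+2}N`. -/
theorem Ideal.exists_sub_sum_mem_of_regGr_le (I : Ideal A) {β : ℝ}
    (h : I.regGr N ≤ (β : EReal)) {n : ℕ} (hn : β < n + 1) (a : Fin I.genCard → N)
    (ha : ∀ j, a j ∈ I ^ (n + 1) • (⊤ : Submodule A N)) (h0 : ∑ j, I.gen j • a j = 0) :
    ∃ b : Fin I.genCard → Fin I.genCard → N,
      (∀ i j, b i j ∈ I ^ n • (⊤ : Submodule A N)) ∧
      ∀ j, a j - ∑ i, I.gen i • (b i j - b j i) ∈ I ^ (n + 2) • (⊤ : Submodule A N) := by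
  set F := I.stableFiltration (⊤ : Submodule A N)
  let α : Fin I.genCard → F.submodule := fun j =>
    ⟨PolynomialModule.single A (n + 1) (a j), fun i => by
      rw [PolynomialModule.coeff_single, Finsupp.single_apply]
      split_ifs with hi
      · subst hi; exact ha j
      · exact zero_mem _⟩
  have hα0 : ∑ j, I.reesGen j • F.toGr (α j) = 0 := by
    have h1 : ∑ j, I.reesGen j • α j = 0 := by
      apply Subtype.ext
      rw [Submodule.coe_sum]
      have h2 : ∀ j, (I.reesGen j • α j).1 =
          PolynomialModule.lsingle A (1 + (n + 1)) (I.gen j • a j) := fun j =>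
        PolynomialModule.monomial_smul_single 1 (I.gen j) (n + 1) (a j)
      rw [Finset.sum_congr rfl fun j _ => h2 j, ← map_sum, h0, map_zero]
      rfl
    simp_rw [← map_smul, ← map_sum, h1, map_zero]
  obtain ⟨c, hc, hac⟩ := GradedCech.exists_eq_sum_smul_sub_of_regularity_le
    F.homogeneousProjections h (n := ((n + 1 : ℕ) : ℤ)) (by push_cast; exact hn)
    (fun j => F.toGr (α j)) (fun j => F.mem_assocGradedPiece_iff.mpr ⟨α j, fun i hi => by
      have : n + 1 ≠ i := by omega
      simp [α, this], rfl⟩) hα0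
  choose z _ hz using fun i j => F.mem_assocGradedPiece_iff.mp (hc i j)
  refine ⟨fun i j => (z i j).1.coeff n, fun i j => (z i j).2 n, fun j => ?_⟩
  let V : F.AssocGraded →ₗ[reesAlgebra I] PolynomialModule A N ⧸ F.shiftOne.submodule :=
    (F.submodule.map F.shiftOne.submodule.mkQ).subtype
  have hV : ∀ x : F.submodule, V (F.toGr x) = F.shiftOne.submodule.mkQ x.1 := fun _ => rfl
  have h1 : PolynomialModule.single A (n + 1) (a j) -
      ∑ i, I.reesGen i • ((z i j).1 - (z j i).1) ∈ F.shiftOne.submodule := by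
    have h2 := congrArg V (hac j)
    rw [map_sum] at h2
    rw [← Submodule.Quotient.mk_eq_zero, ← Submodule.mkQ_apply, map_sub, map_sum, sub_eq_zero]
    refine h2.trans (Finset.sum_congr rfl fun i _ => ?_)
    rw [map_smul, map_smul, map_sub, map_sub, ← hz, ← hz, hV, hV]
  -- Extraction of the coefficient of `t^{n+1}`.
  let e : PolynomialModule A N →+ N := (Finsupp.applyAddHom (n + 1)).comp
    (PolynomialModule.coeffAddEquiv (R := A) (M := N)).toAddMonoidHom
  have h3 : ∀ i, e (I.reesGen i • ((z i j).1 - (z j i).1)) =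
      I.gen i • ((z i j).1.coeff n - (z j i).1.coeff n) := fun i => by
    refine (PolynomialModule.monomial_smul_apply 1 (I.gen i) ((z i j).1 - (z j i).1)
      (n + 1)).trans ?_
    rw [if_pos (by omega), Nat.add_sub_cancel]
    exact congrArg _ (map_sub ((Finsupp.applyAddHom n).comp
      (PolynomialModule.coeffAddEquiv (R := A) (M := N)).toAddMonoidHom) _ _)
  have h4 : e (PolynomialModule.single A (n + 1) (a j) -
      ∑ i, I.reesGen i • ((z i j).1 - (z j i).1)) =
      a j - ∑ i, I.gen i • ((z i j).1.coeff n - (z j i).1.coeff n) := by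
    rw [map_sub, map_sum]
    congr 1
    · exact Finsupp.single_eq_same
    · exact Finset.sum_congr rfl fun i _ => h3 i
  rw [← h4]
  exact h1 (n + 1)

end AssociatedGraded

theorem Ideal.mem_span_range_smul {A : Type*} [CommRing A] {N : Type*} [AddCommGroup N]
    [Module A N] {s : ℕ} (x : Fin s → A) (P : Submodule A N) {y : N}
    (hy : y ∈ Ideal.span (Set.range x) • P) :
    ∃ c : Fin s → N, (∀ j, c j ∈ P) ∧ y = ∑ j, x j • c j := by
  induction hy using Submodule.smul_induction_on' with
  | smul r hr p hp =>
    obtain ⟨c, rfl⟩ := Ideal.mem_span_range_iff_exists_fun.mp hr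
    refine ⟨fun j => c j • p, fun j => P.smul_mem _ hp, ?_⟩
    rw [Finset.sum_smul]
    exact Finset.sum_congr rfl fun j _ => by rw [smul_smul, mul_comm]
  | add y _ y' _ h h' =>
    obtain ⟨c, hc, rfl⟩ := h
    obtain ⟨c', hc', rfl⟩ := h'
    exact ⟨fun j => c j + c' j, fun j => add_mem (hc j) (hc' j), by
      simp only [smul_add, Finset.sum_add_distrib]⟩

/-! ### Artin–Rees numbers from regularity. -/

section ArtinRees

variable {A : Type*} [CommRing A] (I : Ideal A)
  {F : Type*} [AddCommGroup F] [Module A F] {N : Type*} [AddCommGroup N] [Module A N]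
  (π : F →ₗ[A] N)

theorem exists_mem_pow_smul_top_of_surjective (hπ : Function.Surjective π) (n : ℕ) {a : N}
    (ha : a ∈ I ^ n • (⊤ : Submodule A N)) : ∃ y ∈ I ^ n • (⊤ : Submodule A F), π y = a := by
  rw [← LinearMap.range_eq_top.mpr hπ, LinearMap.range_eq_map, ← Submodule.map_smul''] at ha
  exact ha

theorem map_mem_pow_smul_top {n : ℕ} {y : F} (hy : y ∈ I ^ n • (⊤ : Submodule A F)) :
    π y ∈ I ^ n • (⊤ : Submodule A N) := by
  have h := Submodule.mem_map_of_mem (f := π) hy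
  rw [Submodule.map_smul''] at h
  exact Submodule.smul_mono le_rfl le_top h

theorem pow_succ_inf_ker_le_of_regGr_le [IsNoetherianRing A] (hπ : Function.Surjective π) {β : ℝ}
    (h : I.regGr N ≤ (β : EReal)) {n : ℕ} (hn : β < n) (hn0 : 0 < n) :
    I ^ (n + 1) • (⊤ : Submodule A F) ⊓ LinearMap.ker π ≤
      I • (I ^ n • (⊤ : Submodule A F) ⊓ LinearMap.ker π) ⊔
        I ^ (n + 2) • (⊤ : Submodule A F) ⊓ LinearMap.ker π := by
  -- Positivity of the exponent lets the Koszul coefficients lie in its predecessor.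
  obtain ⟨n, rfl⟩ := Nat.exists_eq_succ_of_ne_zero hn0.ne'
  rintro y ⟨hy, hy0⟩
  have hgen : ∀ j, I.gen j ∈ I := fun j =>
    I.span_range_gen.le (Ideal.subset_span ⟨j, rfl⟩)
  have hmul : ∀ m j, ∀ x ∈ I ^ m • (⊤ : Submodule A F),
      I.gen j • x ∈ I ^ (m + 1) • (⊤ : Submodule A F) := fun m j x hx => by
    rw [pow_succ', mul_smul]
    exact Submodule.smul_mem_smul (hgen j) hx
  obtain ⟨c, hc, rfl⟩ : ∃ c : Fin I.genCard → F,
      (∀ j, c j ∈ I ^ (n + 1) • (⊤ : Submodule A F)) ∧ y = ∑ j, I.gen j • c j := by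
    refine Ideal.mem_span_range_smul _ _ ?_
    rwa [I.span_range_gen, smul_smul, ← pow_succ']
  obtain ⟨b, hb, hab⟩ := I.exists_sub_sum_mem_of_regGr_le h (n := n) (by exact_mod_cast hn)
    (fun j => π (c j)) (fun j => map_mem_pow_smul_top I π (hc j)) (by
      simpa using hy0)
  choose B hB hBb using fun i j => exists_mem_pow_smul_top_of_surjective I π hπ n (hb i j)
  choose E hE hEb using fun j => exists_mem_pow_smul_top_of_surjective I π hπ (n + 2) (hab j)
  -- The coefficients corrected by the lifted Koszul boundary and by the error `E j`, so that they
  -- lie in `ker π`.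
  let y' : Fin I.genCard → F := fun j => c j - ∑ i, I.gen i • (B i j - B j i) - E j
  have hy' : ∀ j, y' j ∈ I ^ (n + 1) • (⊤ : Submodule A F) ⊓ LinearMap.ker π := by
    refine fun j => ⟨sub_mem (sub_mem (hc j) (sum_mem fun i _ =>
      hmul _ _ _ (sub_mem (hB i j) (hB j i)))) ?_, ?_⟩
    · exact Submodule.smul_mono_left (Ideal.pow_le_pow_right (by omega)) (hE j)
    · simp [y', hBb, hEb]
  have hzero : ∑ j, I.gen j • ∑ i, I.gen i • (B i j - B j i) = 0 := by
    simp only [Finset.smul_sum, smul_sub, Finset.sum_sub_distrib]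
    rw [sub_eq_zero, Finset.sum_comm]
    exact Finset.sum_congr rfl fun i _ => Finset.sum_congr rfl fun j _ => smul_comm _ _ _
  have hsum : ∑ j, I.gen j • c j = ∑ j, I.gen j • y' j + ∑ j, I.gen j • E j := by
    rw [← Finset.sum_add_distrib, ← sub_zero (∑ j, I.gen j • c j), ← hzero,
      ← Finset.sum_sub_distrib]
    refine Finset.sum_congr rfl fun j _ => ?_
    rw [← smul_sub, ← smul_add]
    simp [y']
  have hmem : ∑ j, I.gen j • y' j ∈
      I • (I ^ (n + 1) • (⊤ : Submodule A F) ⊓ LinearMap.ker π) :=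
    sum_mem fun j _ => Submodule.smul_mem_smul (hgen j) (hy' j)
  rw [hsum]
  refine Submodule.add_mem_sup hmem ⟨sum_mem fun j _ => hmul _ _ _ (hE j), ?_⟩
  have h1 := sub_mem hy0 (Submodule.smul_le_right hmem).2
  rwa [hsum, add_sub_cancel_left] at h1

theorem pow_succ_inf_ker_eq_of_regGr_le [IsNoetherianRing A] [Module.Finite A F]
    (hπ : Function.Surjective π) {β : ℝ} (h : I.regGr N ≤ (β : EReal))
    {n : ℕ} (hn : β < n) (hn0 : 0 < n) :
    I ^ (n + 1) • (⊤ : Submodule A F) ⊓ LinearMap.ker π =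
      I • (I ^ n • (⊤ : Submodule A F) ⊓ LinearMap.ker π) := by
  let W : ℕ → Submodule A F := fun m => I ^ m • (⊤ : Submodule A F) ⊓ LinearMap.ker π
  have hmono : ∀ m, W (n + m) ≤ W n := fun m => inf_le_inf_right _
    (Submodule.smul_mono_left (Ideal.pow_le_pow_right (by omega)))
  -- Each application replaces the error term by one a step deeper, while `I • W (n + m)` stays
  -- inside `I • W n`.
  have hstep : ∀ m, W (n + 1) ≤ I • W n ⊔ W (n + 1 + m) := by
    intro m
    induction m with
    | zero => exact le_sup_right
    | succ m ih =>
      have h1 : W (n + m + 1) ≤ I • W (n + m) ⊔ W (n + m + 2) :=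
        pow_succ_inf_ker_le_of_regGr_le I π hπ h
          (hn.trans_le (by exact_mod_cast Nat.le_add_right n m)) (by omega)
      rw [show n + 1 + m = n + m + 1 by omega] at ih
      rw [show n + 1 + (m + 1) = n + m + 2 by omega]
      exact ih.trans (sup_le le_sup_left (h1.trans
        (sup_le_sup_right (Submodule.smul_mono le_rfl (hmono m)) _)))
  -- This `k` may depend on `F`, but serves only to stop the iteration.
  obtain ⟨k, hk⟩ := I.exists_pow_inf_eq_pow_smul (LinearMap.ker π)
  refine le_antisymm ?_ ?_
  · refine (hstep k).trans (sup_le le_rfl ?_)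
    have h1 : W (n + 1 + k) = I • W (n + k) := by
      change I ^ (n + 1 + k) • (⊤ : Submodule A F) ⊓ LinearMap.ker π =
        I • (I ^ (n + k) • (⊤ : Submodule A F) ⊓ LinearMap.ker π)
      rw [hk (n + 1 + k) (by omega), hk (n + k) (by omega), smul_smul, ← pow_succ']
      congr 2
      omega
    rw [h1]
    exact Submodule.smul_mono le_rfl (hmono k)
  · refine le_inf ?_ (Submodule.smul_le_right.trans inf_le_right)
    rw [pow_succ', mul_smul]
    exact Submodule.smul_mono le_rfl inf_le_left

/-- A bound for the regularity of `G_I(N)` bounds the Artin-Rees number of the kernel of a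
surjection onto `N`. -/
theorem pow_inf_ker_eq_of_regGr_le [IsNoetherianRing A] [Module.Finite A F]
    (hπ : Function.Surjective π) {β : ℝ} (h : I.regGr N ≤ (β : EReal))
    {k : ℕ} (hk : β < k) (hk0 : 0 < k) {n : ℕ} (hn : k ≤ n) :
    I ^ n • (⊤ : Submodule A F) ⊓ LinearMap.ker π =
      I ^ (n - k) • (I ^ k • (⊤ : Submodule A F) ⊓ LinearMap.ker π) := by
  obtain ⟨m, rfl⟩ := Nat.exists_eq_add_of_le hn
  rw [Nat.add_sub_cancel_left]
  clear hn
  induction m with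
  | zero => simp
  | succ m ih =>
    rw [← add_assoc, pow_succ_inf_ker_eq_of_regGr_le I π hπ h
      (hk.trans_le (by exact_mod_cast Nat.le_add_right k m)) (by omega), ih, smul_smul,
      ← pow_succ']

end ArtinRees

/-! ### Uniqueness of minimal free covers and resolutions. -/

section Uniqueness

variable {A : Type*} [CommRing A] [IsLocalRing A]
  {F F' : Type*} [AddCommGroup F] [Module A F]
  [AddCommGroup F'] [Module A F'] [Module.Finite A F']
  {N : Type*} [AddCommGroup N] [Module A N]

/-- Nakayama: the image of `φ` together with `ker π'`, hence with `𝔪 F'`, spans `F'`. -/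
theorem surjective_of_comp_eq_of_ker_le {φ : F →ₗ[A] F'} {π : F →ₗ[A] N} {π' : F' →ₗ[A] N}
    (hπ : Function.Surjective π) (h : π' ∘ₗ φ = π)
    (hker : LinearMap.ker π' ≤ IsLocalRing.maximalIdeal A • (⊤ : Submodule A F')) :
    Function.Surjective φ := by
  rw [← LinearMap.range_eq_top, ← top_le_iff]
  refine Submodule.le_of_le_smul_of_le_jacobson_bot (I := IsLocalRing.maximalIdeal A)
    Module.Finite.fg_top (IsLocalRing.maximalIdeal_le_jacobson _) fun x _ => ?_
  obtain ⟨y, hy⟩ := hπ (π' x)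
  have h1 : x - φ y ∈ LinearMap.ker π' := by
    rw [LinearMap.mem_ker, map_sub, sub_eq_zero, ← hy, ← h]
    rfl
  have h2 := Submodule.add_mem_sup (LinearMap.mem_range_self φ y) (hker h1)
  rwa [add_sub_cancel] at h2

/-- Two minimal free covers of a module are isomorphic. -/
theorem exists_linearEquiv_comp_eq [Module.Finite A F] [Module.Free A F] [Module.Free A F']
    {π : F →ₗ[A] N} {π' : F' →ₗ[A] N} (hπ : Function.Surjective π) (hπ' : Function.Surjective π')
    (hker : LinearMap.ker π ≤ IsLocalRing.maximalIdeal A • (⊤ : Submodule A F))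
    (hker' : LinearMap.ker π' ≤ IsLocalRing.maximalIdeal A • (⊤ : Submodule A F')) :
    ∃ e : F ≃ₗ[A] F', π' ∘ₗ e.toLinearMap = π := by
  obtain ⟨φ, hφ⟩ := Module.projective_lifting_property π' π hπ'
  obtain ⟨ψ, hψ⟩ := Module.projective_lifting_property π π' hπ
  have hφs := surjective_of_comp_eq_of_ker_le hπ hφ hker'
  have hψs := surjective_of_comp_eq_of_ker_le hπ' hψ hker
  have hinj : Function.Injective (ψ ∘ₗ φ) :=
    OrzechProperty.injective_of_surjective_endomorphism _ (hψs.comp hφs)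
  exact ⟨LinearEquiv.ofBijective φ ⟨Function.Injective.of_comp hinj, hφs⟩, hφ⟩

end Uniqueness

namespace MinimalFreeResolution

variable {A : Type u} [CommRing A] [IsLocalRing A] {M : Type v} [AddCommGroup M] [Module A M]

/-- The isomorphism of minimal resolutions, in one degree. -/
theorem exists_linearEquiv_map_range_eq (P Q : MinimalFreeResolution.{u, v, w} A M) (i : ℕ) :
    ∃ e : P.F i ≃ₗ[A] Q.F i,
      (LinearMap.range (P.d i)).map e.toLinearMap = LinearMap.range (Q.d i) := by
  induction i with
  | zero =>
    have hP := LinearMap.exact_iff.mp P.exact_zero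
    have hQ := LinearMap.exact_iff.mp Q.exact_zero
    obtain ⟨e, he⟩ := exists_linearEquiv_comp_eq P.augmentation_surjective
      Q.augmentation_surjective (hP.le.trans (P.minimal 0)) (hQ.le.trans (Q.minimal 0))
    refine ⟨e, ?_⟩
    rw [← hP, ← hQ, ← he, LinearMap.ker_comp]
    exact Submodule.map_comap_eq_of_surjective e.surjective _
  | succ i ih =>
    obtain ⟨e, he⟩ := ih
    have hP := LinearMap.exact_iff.mp (P.exact_succ i)
    have hQ := LinearMap.exact_iff.mp (Q.exact_succ i)
    -- The isomorphism in degree `i` identifies the syzygies, so both modules in degree `i + 1` are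
    -- minimal covers of the same module.
    let ε : LinearMap.range (P.d i) ≃ₗ[A] LinearMap.range (Q.d i) := e.ofSubmodules _ _ he
    let π : P.F (i + 1) →ₗ[A] LinearMap.range (Q.d i) := ε.toLinearMap ∘ₗ (P.d i).rangeRestrict
    have hπ : Function.Surjective π := ε.surjective.comp (P.d i).surjective_rangeRestrict
    have hkP : LinearMap.ker π = LinearMap.range (P.d (i + 1)) := by
      rw [LinearMap.ker_comp, LinearEquiv.ker, ← LinearMap.ker, LinearMap.ker_rangeRestrict, hP]
    have hkQ : LinearMap.ker (Q.d i).rangeRestrict = LinearMap.range (Q.d (i + 1)) := by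
      rw [LinearMap.ker_rangeRestrict, hQ]
    obtain ⟨e', he'⟩ := exists_linearEquiv_comp_eq hπ (Q.d i).surjective_rangeRestrict
      (hkP.le.trans (P.minimal (i + 1))) (hkQ.le.trans (Q.minimal (i + 1)))
    refine ⟨e', ?_⟩
    rw [← hkP, ← hkQ, ← he', LinearMap.ker_comp]
    exact Submodule.map_comap_eq_of_surjective e'.surjective _

/-- The regularity of the `i`-th syzygy controls the next one, which is the kernel of the cover `F i
→ Ω^i`. -/
theorem pow_inf_range_eq_of_regGrSyzygy_le [IsNoetherianRing A]
    (P : MinimalFreeResolution.{u, v, w} A M) (I : Ideal A) {β : ℝ} (i : ℕ)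
    (h : P.regGrSyzygy I i ≤ (β : EReal)) {k : ℕ} (hk : β < k) (hk0 : 0 < k) {n : ℕ}
    (hn : k ≤ n) :
    I ^ n • (⊤ : Submodule A (P.F i)) ⊓ LinearMap.range (P.d i) =
      I ^ (n - k) • (I ^ k • (⊤ : Submodule A (P.F i)) ⊓ LinearMap.range (P.d i)) := by
  cases i with
  | zero =>
    rw [← LinearMap.exact_iff.mp P.exact_zero]
    exact pow_inf_ker_eq_of_regGr_le I _ P.augmentation_surjective h hk hk0 hn
  | succ i =>
    rw [← LinearMap.exact_iff.mp (P.exact_succ i), ← LinearMap.ker_rangeRestrict]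
    exact pow_inf_ker_eq_of_regGr_le I _ (P.d i).surjective_rangeRestrict h hk hk0 hn

end MinimalFreeResolution

theorem mainTheorem8 {A : Type u} [CommRing A] [IsLocalRing A] [IsNoetherianRing A]
    (hCM : IsCohenMacaulayLocalRing A)
    (I : Ideal A) (hI : I.radical = IsLocalRing.maximalIdeal A)
    (M : Type v) [AddCommGroup M] [Module A M] [Module.Finite A M]
    (hreg : ∃ P : MinimalFreeResolution.{u, v, w} A M, ∃ β : ℝ,
      ∀ i : ℕ, P.regGrSyzygy I i ≤ (β : EReal)) :
    ∃ h : ℕ, 0 < h ∧ ∀ P : MinimalFreeResolution.{u, v, w} A M, ∀ n : ℕ, h ≤ n → ∀ i : ℕ,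
      (I ^ n • (⊤ : Submodule A (P.F i))) ⊓ LinearMap.range (P.d i) =
        I ^ (n - h) • ((I ^ h • (⊤ : Submodule A (P.F i))) ⊓ LinearMap.range (P.d i)) := by
  obtain ⟨P, β, hβ⟩ := hreg
  obtain ⟨k, hk⟩ := exists_nat_gt β
  -- The successor makes the bound both positive and larger than `β`.
  refine ⟨k + 1, k.succ_pos, fun Q n hn i => ?_⟩
  have hP := P.pow_inf_range_eq_of_regGrSyzygy_le I i (hβ i) (k := k + 1)
    (hk.trans (by exact_mod_cast k.lt_succ_self)) k.succ_pos hn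
  obtain ⟨e, he⟩ := P.exists_linearEquiv_map_range_eq Q i
  have htop : ∀ m, (I ^ m • (⊤ : Submodule A (P.F i))).map e.toLinearMap =
      I ^ m • (⊤ : Submodule A (Q.F i)) := fun m => by
    rw [Submodule.map_smul'', Submodule.map_top, LinearEquiv.range]
  have hmap := congrArg (Submodule.map e.toLinearMap) hP
  rwa [Submodule.map_smul'', Submodule.map_inf _ e.injective, Submodule.map_inf _ e.injective,
    htop, htop, he] at hmap
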